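/- Let $\mathbb M^2$ be the space of real $2\times2$ matrices with $\langle A,B\rangle=\sum_{i,j}A_{ij}B_{ij}$ and $|A|=\langle A,A\rangle^{1/2}$. Put $$Z=\begin{bmatrix}0&-1\\1&0\end{bmatrix},\qquad U(\theta)=\begin{bmatrix}\cos\theta&-\sin\theta\\\sin\theta&\cos\theta\end{bmatrix},$$ let $\operatorname{cof}A$ be the cofactor matrix of $A$, and let $$\mathcal D=\{(A,B)\in\mathbb M^2\times\mathbb M^2:\det A=1,\ \langle B,\operatorname{cof}A\rangle=0\}$$ be the tangent bundle of ${\rm SL}(2,\mathbb R)$. For $\kappa>0$ a *solution* is a map $A\in C^0(\mathbb R,{\rm SL}(2,\mathbb R))\cap C^2(\mathbb R,\mathbb M^2)$ such that $$\ddot A(t)+\kappa A(t)=\lambda(t)\operatorname{cof}A(t),\qquad t\in\mathbb R,$$ for some continuous $\lambda:\mathbb R\to\mathbb R$. Let $$X_1(A,B)=\tfrac12|B|^2+\tfrac\kappa2|A|^2,\quad X_2(A,B)=\tfrac12\langle ZA-AZ,B\rangle,\quad X_3(A,B)=\tfrac12\langle ZA+AZ,B\rangle .$$ **Theorem.** Let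 $\kappa>0$, let $X_3\in\mathbb R$ satisfy $X_3^2>8\kappa$, let $X_1=\kappa+\tfrac14X_3^2$, and let $$\mathcal W(X_3)=\{(A,B)\in\mathcal D:\ X_1(A,B)=X_1,\ X_2(A,B)=0,\ X_3(A,B)=X_3\}.$$ 1. $\mathcal W(X_3)$ is nonempty, and it contains points $(A,B)$ with $A\notin{\rm SO}(2,\mathbb R)$. 2. $\mathcal W(X_3)$ is invariant: if $A$ is a solution and $(A(s),\dot A(s))\in\mathcal W(X_3)$ for some $s\in\mathbb R$, then $(A(t),\dot A(t))\in\mathcal W(X_3)$ for all $t\in\mathbb R$. 3. Let $A$ be a solution with $(A(0),\dot A(0))\in\mathcal W(X_3)$. There are $T>0$ and phases $\theta_+,\theta_-\in\mathbb R$ such that for every $\mu$ with $0<\mu<\tfrac12(X_3^2-8\kappa)^{1/2}$ there is a constant $C$ with, for $j=0,1$, $$\left|\left(\frac{d}{dt}\right)^j\left[A(t)-U\left(\tfrac12X_3t+\theta_+\right)\right]\right|\le Ce^{-\mu t},\qquad t>T,$$ $$\left|\left(\frac{d}{dt}\right)^j\left[A(t)-U\left(\tfrac12X_3t+\theta_-\right)\right]\right|\le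 Ce^{\mu t},\qquad t<-T.$$ If moreover $A(0)\notin{\rm SO}(2,\mathbb R)$, then $T$ can be taken such that also $$\langle A(t),\dot A(t)\rangle<0\quad(t>T),\qquad \langle A(t),\dot A(t)\rangle>0\quad(t<-T).$$ 4. Every solution $A$ with $(A(0),\dot A(0))\in\mathcal W(X_3)$ and $A(0)\notin{\rm SO}(2,\mathbb R)$ is homoclinic to the orbit of the rotating disk $$\mathcal R=\left\{\left(U(\tfrac12X_3t),\tfrac{d}{dt}U(\tfrac12X_3t)\right):t\in\mathbb R\right\}:$$ $(A(t),\dot A(t))\notin\mathcal R$ for all $t$, and for every $\mu$ with $0<\mu<\tfrac12(X_3^2-8\kappa)^{1/2}$, $$\lim_{|t|\to\infty}e^{\mu|t|}\operatorname{dist}\left[(A(t),\dot A(t)),\mathcal R\right]=0 .$$ -/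

import Mathlib

open Filter Topology

/- `2 × 2` real matrices carry the Euclidean norm `|A| = (∑ A_ij ^ 2) ^ (1/2)`. -/
attribute [local instance] Matrix.frobeniusNormedAddCommGroup Matrix.frobeniusNormedSpace

namespace AffineMHD

/-- The vector space `𝕄²` of real `2 × 2` matrices. -/
abbrev Mat : Type := Matrix (Fin 2) (Fin 2) ℝ

/-- The Euclidean inner product `⟨A, B⟩ = ∑ A_ij B_ij = tr (Aᵀ B)`. -/
def ip (A B : Mat) : ℝ := ∑ i, ∑ j, A i j * B i j

/-- The matrix `Z = [[0, -1], [1, 0]]`. -/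
def Z : Mat := !![0, -1; 1, 0]

/-- The rotation `U(θ)`. -/
noncomputable def U (θ : ℝ) : Mat :=
  !![Real.cos θ, -Real.sin θ; Real.sin θ, Real.cos θ]

/-- The cofactor matrix. -/
def cof (A : Mat) : Mat := A.adjugate.transpose

/-- Membership in `SO(2, ℝ)`. -/
def IsRotation (A : Mat) : Prop := A ∈ Matrix.specialOrthogonalGroup (Fin 2) ℝ

/-- The phase space: the tangent bundle of `SL(2, ℝ)`, as a subset of `𝕄² × 𝕄²`. -/
def phaseSpace : Set (Mat × Mat) := {P | P.1.det = 1 ∧ ip P.2 (cof P.1) = 0}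

/-- The energy `X₁`. -/
noncomputable def X₁ (κ : ℝ) (A B : Mat) : ℝ := 1 / 2 * ‖B‖ ^ 2 + κ / 2 * ‖A‖ ^ 2

/-- The invariant `X₂`. -/
noncomputable def X₂ (A B : Mat) : ℝ := 1 / 2 * ip (Z * A - A * Z) B

/-- The invariant `X₃`. -/
noncomputable def X₃ (A B : Mat) : ℝ := 1 / 2 * ip (Z * A + A * Z) B

/-- The set `𝒲(x₃)` of phase points with `X₁ = κ + x₃ ^ 2 / 4`, `X₂ = 0` and `X₃ = x₃`. -/
def W (κ x₃ : ℝ) : Set (Mat × Mat) :=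
  {P | P ∈ phaseSpace ∧ X₁ κ P.1 P.2 = κ + 1 / 4 * x₃ ^ 2 ∧ X₂ P.1 P.2 = 0 ∧ X₃ P.1 P.2 = x₃}

/-- `A ∈ C⁰(ℝ, SL(2, ℝ)) ∩ C²(ℝ, 𝕄²)` solves `A'' + κ A = λ(t) cof A` for some continuous
scalar function `λ`. -/
def IsSolution (κ : ℝ) (A : ℝ → Mat) : Prop :=
  ContDiff ℝ 2 A ∧ (∀ t, (A t).det = 1) ∧
    ∃ lam : ℝ → ℝ, Continuous lam ∧ ∀ t, deriv (deriv A) t + κ • A t = lam t • cof (A t)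

/-- The orbit in phase space of the rigid rotation `t ↦ U(x₃ t / 2)`, the rotating disk. -/
noncomputable def rotatingDiskOrbit (x₃ : ℝ) : Set (Mat × Mat) :=
  Set.range fun t : ℝ =>
    (U (1 / 2 * x₃ * t), deriv (fun s : ℝ => U (1 / 2 * x₃ * s)) t)

end AffineMHD

/-! Split a matrix into its conformal part `p` and anticonformal part `q`, both vectors in the
plane. The cofactor map fixes `p` and negates `q`, so the equation of motion becomes two
central-force problems, p'' = (λ - κ)p and q'' = -(λ + κ)q, coupled by |p|² = 1 + |q|². Up to a
factor, `X₃` and `X₂` are the angular momenta of `p` and `q`, hence conserved; `X₁` is conserved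
because the constraint force does no work on tangent velocities.

With s = |q|² and r = q·q' = s'/2, the conservation laws on `W` reduce to r²(1 + 2s) = s²(ν² - 2κs),
where ν² = x²/4 - 2κ > 0 (`ReducedOrbit.r_sq`). The right side has a double zero at s = 0, the
rotations, and a simple zero at s = ν²/(2κ), the turning point: this is the phase portrait of a
homoclinic loop. For s > 0 the quotient u = r/s solves an autonomous equation that integrates
explicitly (`ReducedOrbit.exists_decay`): u tends to -ν and s = O(e^{-2νt}).

The deviation of p' from rotation at angular speed x/2 is O(s), hence integrable, so `p` viewed in
the rotating frame has a limit, a unit vector e^{iθ}; `q` and q' are O(√s) = O(e^{-νt})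
(`ReducedOrbit.exists_asymptotics`). Backward time follows from the reversal t ↦ -t, which sends x
to -x. The bounds hold at the rate ν itself; μ < ν makes the weighted distance tend to zero. -/

/-! ### Two differential inequalities on the line. -/

/-- A function whose derivative decays exponentially converges exponentially. -/
theorem exists_limit_of_deriv_le_exp {f f' : ℝ → ℝ} {C a : ℝ} (ha : 0 < a)
    (hf : ∀ t, HasDerivAt f (f' t) t) (hb : ∀ t, 0 ≤ t → |f' t| ≤ C * Real.exp (-a * t)) :
    ∃ L, ∀ t, 0 ≤ t → |f t - L| ≤ C / a * Real.exp (-a * t) := by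
  have hE : ∀ t : ℝ, HasDerivAt (fun t => C / a * Real.exp (-a * t)) (-(C * Real.exp (-a * t))) t := by
    intro t
    have h := (((hasDerivAt_id t).const_mul (-a)).exp).const_mul (C / a)
    refine h.congr_deriv ?_
    simp only [id]
    field_simp
  have hC : 0 ≤ C := by
    have := (abs_nonneg _).trans (hb 0 le_rfl)
    simpa using this
  -- The limit is trapped between the increasing f - (C/a)e^{-at} and the decreasing f +
  -- (C/a)e^{-at}; no integral of `f'` is needed.
  have hanti : AntitoneOn (fun t => f t + C / a * Real.exp (-a * t)) (Set.Ici 0) := by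
    refine antitoneOn_of_deriv_nonpos (convex_Ici 0)
      (fun t _ => ((hf t).add (hE t)).continuousAt.continuousWithinAt)
      (fun t _ => ((hf t).add (hE t)).differentiableAt.differentiableWithinAt) fun t ht => ?_
    rw [interior_Ici] at ht
    have h := ((hf t).add (hE t)).deriv
    have h2 := (abs_le.1 (hb t (le_of_lt ht))).2
    change deriv (f + fun t => C / a * Real.exp (-a * t)) t ≤ 0
    rw [h]; linarith
  have hmono : MonotoneOn (fun t => f t - C / a * Real.exp (-a * t)) (Set.Ici 0) := by
    refine monotoneOn_of_deriv_nonneg (convex_Ici 0)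
      (fun t _ => ((hf t).sub (hE t)).continuousAt.continuousWithinAt)
      (fun t _ => ((hf t).sub (hE t)).differentiableAt.differentiableWithinAt) fun t ht => ?_
    rw [interior_Ici] at ht
    have h := ((hf t).sub (hE t)).deriv
    have h2 := (abs_le.1 (hb t (le_of_lt ht))).1
    change 0 ≤ deriv (f - fun t => C / a * Real.exp (-a * t)) t
    rw [h]; linarith
  have hcross : ∀ s t : ℝ, 0 ≤ s → 0 ≤ t →
      f s - C / a * Real.exp (-a * s) ≤ f t + C / a * Real.exp (-a * t) := by
    intro s t hs ht
    have h1 := hmono (Set.mem_Ici.2 hs) (Set.mem_Ici.2 (hs.trans (le_max_left s t))) (le_max_left s t)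
    have h2 := hanti (Set.mem_Ici.2 ht) (Set.mem_Ici.2 (ht.trans (le_max_right s t)))
      (le_max_right s t)
    have h3 : 0 ≤ C / a * Real.exp (-a * max s t) := by positivity
    simp only at h1 h2
    linarith
  have hbdd : BddAbove ((fun t => f t - C / a * Real.exp (-a * t)) '' Set.Ici 0) := by
    refine ⟨f 0 + C / a * Real.exp (-a * 0), ?_⟩
    rintro _ ⟨s, hs, rfl⟩
    exact hcross s 0 hs le_rfl
  refine ⟨sSup ((fun t => f t - C / a * Real.exp (-a * t)) '' Set.Ici 0), fun t ht => ?_⟩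
  have h1 := le_csSup hbdd ⟨t, ht, rfl⟩
  have h2 : sSup ((fun t => f t - C / a * Real.exp (-a * t)) '' Set.Ici 0) ≤
      f t + C / a * Real.exp (-a * t) := by
    refine csSup_le ⟨_, ⟨t, ht, rfl⟩⟩ ?_
    rintro _ ⟨s, hs, rfl⟩
    exact hcross s t hs ht
  simp only at h1
  rw [abs_le]
  constructor <;> linarith

/-- A positive lower bound for a function whose logarithmic derivative is bounded. -/
theorem pos_of_abs_deriv_le {f f' : ℝ → ℝ} {k : ℝ} (hf : ∀ t, HasDerivAt f (f' t) t)
    (hb : ∀ t, |f' t| ≤ k * f t) {t₀ : ℝ} (h₀ : 0 < f t₀) (t : ℝ) : 0 < f t := by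
  have hE : ∀ (c t : ℝ), HasDerivAt (fun t => Real.exp (c * t) * f t)
      (Real.exp (c * t) * (f' t + c * f t)) t := by
    intro c t
    have h := (((hasDerivAt_id t).const_mul c).exp).mul (hf t)
    refine h.congr_deriv ?_
    simp only [id]
    ring
  have hmono : Monotone (fun t => Real.exp (k * t) * f t) := by
    refine monotone_of_deriv_nonneg (fun t => (hE k t).differentiableAt) fun t => ?_
    rw [(hE k t).deriv]
    exact mul_nonneg (Real.exp_pos _).le (by linarith [(abs_le.1 (hb t)).1])
  have hanti : Antitone (fun t => Real.exp (-k * t) * f t) := by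
    refine antitone_of_deriv_nonpos (fun t => (hE (-k) t).differentiableAt) fun t => ?_
    rw [(hE (-k) t).deriv]
    exact mul_nonpos_of_nonneg_of_nonpos (Real.exp_pos _).le
      (by linarith [(abs_le.1 (hb t)).2])
  rcases le_total t₀ t with h | h
  · have := (mul_pos (Real.exp_pos (k * t₀)) h₀).trans_le (hmono h)
    exact pos_of_mul_pos_right this (Real.exp_pos _).le
  · have := (mul_pos (Real.exp_pos (-k * t₀)) h₀).trans_le (hanti h)
    exact pos_of_mul_pos_right this (Real.exp_pos _).le

/-! ### The reduced system for the conformal and anticonformal parts. -/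

namespace AffineMHD

/-- The rate `ν = (x² - 8κ)^(1/2) / 2`. -/
noncomputable def rate (κ x : ℝ) : ℝ := 1 / 2 * Real.sqrt (x ^ 2 - 8 * κ)

theorem rate_pos {κ x : ℝ} (hx : 8 * κ < x ^ 2) : 0 < rate κ x := by
  have := Real.sqrt_pos.2 (sub_pos.2 hx)
  unfold rate; positivity

theorem rate_sq {κ x : ℝ} (hx : 8 * κ < x ^ 2) : rate κ x ^ 2 = x ^ 2 / 4 - 2 * κ := by
  unfold rate
  rw [mul_pow, Real.sq_sqrt (sub_pos.2 hx).le]; ring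

/-- A solution with data in `𝒲(x)`, written in terms of the conformal part `p` and the
anticonformal part `q` of the matrix, with velocities `v` and `w`. -/
structure ReducedOrbit (κ x : ℝ) where
  (p₁ p₂ q₁ q₂ v₁ v₂ w₁ w₂ lam : ℝ → ℝ)
  hp₁ : ∀ t, HasDerivAt p₁ (v₁ t) t
  hp₂ : ∀ t, HasDerivAt p₂ (v₂ t) t
  hq₁ : ∀ t, HasDerivAt q₁ (w₁ t) t
  hq₂ : ∀ t, HasDerivAt q₂ (w₂ t) t
  hv₁ : ∀ t, HasDerivAt v₁ ((lam t - κ) * p₁ t) t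
  hv₂ : ∀ t, HasDerivAt v₂ ((lam t - κ) * p₂ t) t
  hw₁ : ∀ t, HasDerivAt w₁ (-(lam t + κ) * q₁ t) t
  hw₂ : ∀ t, HasDerivAt w₂ (-(lam t + κ) * q₂ t) t
  det_eq : ∀ t, p₁ t ^ 2 + p₂ t ^ 2 = 1 + (q₁ t ^ 2 + q₂ t ^ 2)
  tangent : ∀ t, p₁ t * v₁ t + p₂ t * v₂ t = q₁ t * w₁ t + q₂ t * w₂ t
  energy : ∀ t, v₁ t ^ 2 + v₂ t ^ 2 + (w₁ t ^ 2 + w₂ t ^ 2) + 2 * κ * (q₁ t ^ 2 + q₂ t ^ 2) =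
    x ^ 2 / 4
  momentum_p : ∀ t, p₁ t * v₂ t - p₂ t * v₁ t = x / 2
  momentum_q : ∀ t, q₁ t * w₂ t - q₂ t * w₁ t = 0

namespace ReducedOrbit

variable {κ x : ℝ} (O : ReducedOrbit κ x)

/-- The squared size of the anticonformal part. -/
def s (t : ℝ) : ℝ := O.q₁ t ^ 2 + O.q₂ t ^ 2

/-- Half the derivative of `s`. -/
def r (t : ℝ) : ℝ := O.q₁ t * O.w₁ t + O.q₂ t * O.w₂ t

theorem s_nonneg (t : ℝ) : 0 ≤ O.s t := by unfold s; positivity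

theorem hasDerivAt_s (t : ℝ) : HasDerivAt O.s (2 * O.r t) t := by
  have h := ((O.hq₁ t).pow 2).add ((O.hq₂ t).pow 2)
  refine h.congr_deriv ?_
  simp only [r]; push_cast; ring

theorem hasDerivAt_r (t : ℝ) :
    HasDerivAt O.r (O.w₁ t ^ 2 + O.w₂ t ^ 2 - (O.lam t + κ) * O.s t) t := by
  have h := ((O.hq₁ t).mul (O.hw₁ t)).add ((O.hq₂ t).mul (O.hw₂ t))
  refine h.congr_deriv ?_
  simp only [s]; ring

/-- By `tangent`, r = p·v as well as q·w. Comparing the two expressions for r' eliminates the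
multiplier `lam`. -/
theorem hasDerivAt_r' (t : ℝ) :
    HasDerivAt O.r (O.v₁ t ^ 2 + O.v₂ t ^ 2 + (O.lam t - κ) * (1 + O.s t)) t := by
  have h := ((O.hp₁ t).mul (O.hv₁ t)).add ((O.hp₂ t).mul (O.hv₂ t))
  have e : O.r = O.p₁ * O.v₁ + O.p₂ * O.v₂ := by
    funext t; simp [r, O.tangent t]
  rw [e]
  refine h.congr_deriv ?_
  have := O.det_eq t
  simp only [s]; linear_combination (O.lam t - κ) * this

/-- Lagrange's identity |q|²|w|² = (q·w)² + (q×w)² with q×w = 0; the same identity for `p` and `v`,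
where p×v = x/2, gives `s_mul_v_sq`. -/
theorem s_mul_w_sq (t : ℝ) : O.s t * (O.w₁ t ^ 2 + O.w₂ t ^ 2) = O.r t ^ 2 := by
  have h := O.momentum_q t
  simp only [s, r]
  linear_combination (O.q₁ t * O.w₂ t - O.q₂ t * O.w₁ t) * h

theorem s_mul_v_sq (t : ℝ) :
    (1 + O.s t) * (O.v₁ t ^ 2 + O.v₂ t ^ 2) = O.r t ^ 2 + x ^ 2 / 4 := by
  have h := O.momentum_p t
  have h2 := O.tangent t
  have h3 := O.det_eq t
  simp only [s, r]
  linear_combination (O.p₁ t * O.v₂ t - O.p₂ t * O.v₁ t + x / 2) * h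
    + (O.p₁ t * O.v₁ t + O.p₂ t * O.v₂ t + (O.q₁ t * O.w₁ t + O.q₂ t * O.w₂ t)) * h2
    - (O.v₁ t ^ 2 + O.v₂ t ^ 2) * h3

variable (hκ : 0 < κ) (hx : 8 * κ < x ^ 2)
include hx

/-- Multiply the energy law by s(1 + s) and insert the two Lagrange identities. The terms linear in
s cancel exactly because of the energy level chosen in `W`. -/
theorem r_sq (t : ℝ) :
    O.r t ^ 2 * (1 + 2 * O.s t) = O.s t ^ 2 * (rate κ x ^ 2 - 2 * κ * O.s t) := by
  have h1 := O.s_mul_w_sq t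
  have h2 := O.s_mul_v_sq t
  have h3 := O.energy t
  change _ + 2 * κ * O.s t = _ at h3
  rw [rate_sq hx]
  linear_combination (-(1 + O.s t)) * h1 - O.s t * h2 + O.s t * (1 + O.s t) * h3

include hκ

theorem r_sq_le (t : ℝ) : O.r t ^ 2 ≤ rate κ x ^ 2 * O.s t ^ 2 := by
  have h := O.r_sq hx t
  have hs := O.s_nonneg t
  have h1 : 0 ≤ O.r t ^ 2 * O.s t := by positivity
  have h2 : 0 ≤ κ * O.s t ^ 3 := by positivity
  nlinarith

theorem abs_r_le (t : ℝ) : |O.r t| ≤ rate κ x * O.s t := by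
  refine abs_le_of_sq_le_sq ?_ (mul_nonneg (rate_pos hx).le (O.s_nonneg t))
  rw [mul_pow]
  exact O.r_sq_le hκ hx t

/-- Where s > 0, divide `s_mul_w_sq` by s. Where s = 0, |v|² already exhausts the energy x²/4, which
forces w = 0. -/
theorem w_sq_le (t : ℝ) : O.w₁ t ^ 2 + O.w₂ t ^ 2 ≤ rate κ x ^ 2 * O.s t := by
  have h1 := O.s_mul_w_sq t
  have h2 := O.r_sq_le hκ hx t
  rcases (O.s_nonneg t).eq_or_lt with hs | hs
  · have hr : O.r t ^ 2 = 0 := by rw [← h1, ← hs, zero_mul]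
    have h3 := O.s_mul_v_sq t
    have h4 := O.energy t
    change _ + 2 * κ * O.s t = _ at h4
    rw [← hs] at h3 h4 ⊢
    linarith
  · refine le_of_mul_le_mul_left ?_ hs
    rw [h1]; linarith

/-- Since |s'| ≤ 2νs, the function s vanishes identically or never: an orbit off the rotations does
not reach them in finite time. -/
theorem s_pos {t₀ : ℝ} (h₀ : 0 < O.s t₀) (t : ℝ) : 0 < O.s t := by
  refine pos_of_abs_deriv_le (k := 2 * rate κ x) O.hasDerivAt_s (fun t => ?_) h₀ t
  rw [abs_mul, abs_two]
  linarith [O.abs_r_le hκ hx t]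

/-- Explicit integration of the reduced equation: half the logarithmic derivative `u` of `s` obeys
`u' = -(ν² - u²)(κ + u²)/(κ + ν²)` and tends to `-ν` at an exponential rate. -/
theorem exists_decay (h₀ : 0 < O.s 0) :
    ∃ C, 0 < C ∧ ∀ t, rate κ x + O.r t / O.s t ≤ C * Real.exp (-(2 * rate κ x) * t) ∧
      O.s t ≤ C * Real.exp (-(2 * rate κ x) * t) := by
  set ν := rate κ x with hνdef
  have hν : 0 < ν := rate_pos hx
  have hν2 : ν ^ 2 = x ^ 2 / 4 - 2 * κ := rate_sq hx
  have hs := O.s_pos hκ hx h₀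
  set u : ℝ → ℝ := fun t => O.r t / O.s t with hu
  have hru : ∀ t, O.r t = u t * O.s t := fun t => by
    simp only [hu]; field_simp [(hs t).ne']
  have hsu : ∀ t, 2 * O.s t * (u t ^ 2 + κ) = ν ^ 2 - u t ^ 2 := by
    intro t
    have h := O.r_sq hx t
    rw [hru] at h
    have hs2 : O.s t ^ 2 ≠ 0 := pow_ne_zero _ (hs t).ne'
    apply mul_left_cancel₀ hs2
    linear_combination h
  have hpos : ∀ t, 0 < ν + u t ∧ 0 < ν - u t := by
    intro t
    have h : u t ^ 2 < ν ^ 2 := by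
      have : 0 < 2 * O.s t * (u t ^ 2 + κ) := by have := hs t; positivity
      linarith [hsu t]
    have := abs_lt_of_sq_lt_sq' h hν.le
    constructor <;> linarith
  have hu' : ∀ t, HasDerivAt u (-((ν ^ 2 - u t ^ 2) * (κ + u t ^ 2) / (κ + ν ^ 2))) t := by
    intro t
    have hst := hs t
    refine ((O.hasDerivAt_r t).div (O.hasDerivAt_s t) hst.ne').congr_deriv ?_
    have e := (O.hasDerivAt_r t).unique (O.hasDerivAt_r' t)
    have e1 := O.s_mul_w_sq t
    have e2 := O.s_mul_v_sq t
    have e3 := hsu t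
    rw [hru] at e1 e2
    rw [hru]
    set S := O.s t
    set R := u t
    set Wq := O.w₁ t ^ 2 + O.w₂ t ^ 2
    set V := O.v₁ t ^ 2 + O.v₂ t ^ 2
    have e1' : Wq = R ^ 2 * S := by
      apply mul_left_cancel₀ hst.ne'
      linear_combination e1
    have hd : 1 + 2 * S ≠ 0 := by positivity
    have hk : κ + R ^ 2 ≠ 0 := by positivity
    have hden : κ + ν ^ 2 = (1 + 2 * S) * (κ + R ^ 2) := by linear_combination -e3
    -- The multiplier drops out on adding S times the equality `e` of the two formulas for r'.
    have hlam : (1 + 2 * S) * (Wq - (O.lam t + κ) * S) = S * V + (1 + S) * Wq - 2 * κ * S * (1 + S) := by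
      linear_combination S * e
    have hSV : S * V + (1 + S) * Wq - 2 * κ * S * (1 + S) - 2 * R ^ 2 * S * (1 + 2 * S)
        = - (2 * S ^ 2 * (κ + R ^ 2)) := by
      have h4 : (1 + S) ≠ 0 := by positivity
      apply mul_left_cancel₀ h4
      rw [e1']
      linear_combination S * e2 - S * e3 - S * hν2
    have hnum : Wq - (O.lam t + κ) * S - 2 * R ^ 2 * S = - (2 * S ^ 2 * (κ + R ^ 2)) / (1 + 2 * S) := by
      rw [eq_div_iff hd]
      linear_combination hlam + hSV
    have hlhs : ((Wq - (O.lam t + κ) * S) * S - R * S * (2 * (R * S))) / S ^ 2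
        = (Wq - (O.lam t + κ) * S - 2 * R ^ 2 * S) / S := by
      field_simp
    rw [hlhs, hnum, hden, ← e3]
    field_simp
    ring
  have hκs : 0 < Real.sqrt κ := Real.sqrt_pos.2 hκ
  have hκ2 : Real.sqrt κ ^ 2 = κ := Real.sq_sqrt hκ.le
  set k := Real.sqrt κ
  -- First integral from the partial fractions (κ + ν²)/((ν² - u²)(κ + u²)) = 1/(ν² - u²) + 1/(κ +
  -- u²), multiplied by 2ν.
  have hG : ∀ t, HasDerivAt (fun t => Real.log (ν + u t) - Real.log (ν - u t)
      + 2 * ν / k * Real.arctan (u t / k) + 2 * ν * t) 0 t := by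
    intro t
    obtain ⟨hp, hm⟩ := hpos t
    have h := (((((hu' t).const_add ν).log hp.ne').sub (((hu' t).const_sub ν).log hm.ne')).add
      ((((hu' t).div_const k).arctan).const_mul (2 * ν / k))).add
      ((hasDerivAt_id t).const_mul (2 * ν))
    refine h.congr_deriv ?_
    have hk : 0 < κ + u t ^ 2 := by positivity
    have hk2 : 0 < κ + ν ^ 2 := by positivity
    have e : ν ^ 2 - u t ^ 2 = (ν + u t) * (ν - u t) := by ring
    have e2 : 1 + (u t / k) ^ 2 = (κ + u t ^ 2) / k ^ 2 := by
      rw [hκ2, div_pow, hκ2]; field_simp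
    rw [e2, e]
    field_simp
    ring
  have hconst : ∀ t, Real.log (ν + u t) - Real.log (ν - u t)
      + 2 * ν / k * Real.arctan (u t / k) + 2 * ν * t = Real.log (ν + u 0) - Real.log (ν - u 0)
      + 2 * ν / k * Real.arctan (u 0 / k) + 2 * ν * 0 := fun t =>
    is_const_of_deriv_eq_zero (fun t => (hG t).differentiableAt) (fun t => (hG t).deriv) t 0
  set G := Real.log (ν + u 0) - Real.log (ν - u 0)
      + 2 * ν / k * Real.arctan (u 0 / k) + 2 * ν * 0
  have hbound : ∀ t, ν + u t ≤ 2 * ν * Real.exp (G + 2 * ν / k * (Real.pi / 2)) *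
      Real.exp (-(2 * ν) * t) := by
    intro t
    obtain ⟨hp, hm⟩ := hpos t
    have h1 : Real.log (ν - u t) ≤ Real.log (2 * ν) := Real.log_le_log hm (by linarith)
    have h2 : 2 * ν / k * (-(Real.pi / 2)) ≤ 2 * ν / k * Real.arctan (u t / k) :=
      mul_le_mul_of_nonneg_left (Real.neg_pi_div_two_lt_arctan _).le (by positivity)
    have h3 := hconst t
    have h4 : Real.log (ν + u t) ≤
        Real.log (2 * ν) + (G + 2 * ν / k * (Real.pi / 2)) + -(2 * ν) * t := by linarith
    rw [← Real.exp_log hp]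
    refine (Real.exp_le_exp.2 h4).trans_eq ?_
    rw [Real.exp_add, Real.exp_add, Real.exp_log (by positivity)]
  set D := 2 * ν * Real.exp (G + 2 * ν / k * (Real.pi / 2))
  have hD : 0 < D := by positivity
  refine ⟨D + ν / κ * D, by positivity, fun t => ?_⟩
  have hE := Real.exp_pos (-(2 * ν) * t)
  have hb := hbound t
  constructor
  · have : 0 ≤ ν / κ * D * Real.exp (-(2 * ν) * t) := by positivity
    have e : ν + O.r t / O.s t = ν + u t := rfl
    rw [e]; linarith
  · obtain ⟨hp, hm⟩ := hpos t
    -- From 2s(u² + κ) = (ν - u)(ν + u), using ν - u < 2ν and dropping the term su².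
    have h1 : O.s t ≤ ν / κ * (ν + u t) := by
      rw [div_mul_eq_mul_div, le_div_iff₀ hκ]
      have h2 := hsu t
      have h3 : 0 ≤ O.s t * u t ^ 2 := by have := hs t; positivity
      nlinarith
    have h2 : ν / κ * (ν + u t) ≤ ν / κ * (D * Real.exp (-(2 * ν) * t)) :=
      mul_le_mul_of_nonneg_left hb (by positivity)
    have : 0 ≤ D * Real.exp (-(2 * ν) * t) := by positivity
    linarith

theorem exists_s_le : ∃ C, 0 ≤ C ∧ ∀ t, O.s t ≤ C * Real.exp (-(2 * rate κ x) * t) := by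
  rcases (O.s_nonneg 0).eq_or_lt with h | h
  · refine ⟨0, le_rfl, fun t => ?_⟩
    rw [zero_mul]
    by_contra! ht
    exact (O.s_pos hκ hx ht 0).ne h
  · obtain ⟨C, hC, h⟩ := O.exists_decay hκ hx h
    exact ⟨C, hC.le, fun t => (h t).2⟩

/-- Eventually the anticonformal part shrinks. -/
theorem exists_r_neg (h₀ : 0 < O.s 0) : ∃ T, 0 < T ∧ ∀ t, T < t → O.r t < 0 := by
  obtain ⟨C, hC, h⟩ := O.exists_decay hκ hx h₀
  have hν := rate_pos hx
  have hlim : Tendsto (fun t : ℝ => C * Real.exp (-(2 * rate κ x) * t)) atTop (𝓝 (C * 0)) := by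
    refine Tendsto.const_mul C (Real.tendsto_exp_atBot.comp ?_)
    exact tendsto_id.const_mul_atTop_of_neg (by linarith)
  rw [mul_zero] at hlim
  obtain ⟨T, hT⟩ := eventually_atTop.1 (hlim.eventually (gt_mem_nhds hν))
  refine ⟨max T 1, by positivity, fun t ht => ?_⟩
  have h1 := hT t ((le_max_left _ _).trans ht.le)
  have h2 := (h t).1
  have hs := O.s_pos hκ hx h₀ t
  have h3 : O.r t / O.s t < 0 := by linarith
  by_contra! hr
  exact absurd (div_nonneg hr hs.le) (not_le.2 h3)

/-- The conformal velocity deviates from the rigid rotation by a multiple of `s`. -/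
theorem abs_velocity_defect_le (t : ℝ) :
    (O.v₁ t + x / 2 * O.p₂ t) ^ 2 + (O.v₂ t - x / 2 * O.p₁ t) ^ 2 ≤
      ((rate κ x + |x|) * O.s t) ^ 2 := by
  have h1 := O.s_mul_v_sq t
  have h2 := O.momentum_p t
  have h3 := O.det_eq t
  change _ = 1 + O.s t at h3
  have hs := O.s_nonneg t
  have hr := O.r_sq_le hκ hx t
  -- The cross term is known from p×v = x/2, and the x² terms combine to (1 - (1 + s))² = s².
  have e : (1 + O.s t) * ((O.v₁ t + x / 2 * O.p₂ t) ^ 2 + (O.v₂ t - x / 2 * O.p₁ t) ^ 2)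
      = O.r t ^ 2 + x ^ 2 / 4 * O.s t ^ 2 := by
    linear_combination h1 - (1 + O.s t) * x * h2 + (1 + O.s t) * x ^ 2 / 4 * h3
  have hν := rate_pos hx
  have h5 : 0 ≤ rate κ x * |x| * O.s t ^ 2 := by positivity
  have h6 : 0 ≤ O.s t * ((O.v₁ t + x / 2 * O.p₂ t) ^ 2 + (O.v₂ t - x / 2 * O.p₁ t) ^ 2) := by
    positivity
  have h7 : 0 ≤ x ^ 2 * O.s t ^ 2 := by positivity
  have h8 : ((rate κ x + |x|) * O.s t) ^ 2 =
      rate κ x ^ 2 * O.s t ^ 2 + 2 * (rate κ x * |x| * O.s t ^ 2) + x ^ 2 * O.s t ^ 2 := by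
    rw [← sq_abs x]; ring
  rw [h8]; linarith

/-- Exponential convergence to a rigid rotation, in coordinates. -/
theorem exists_asymptotics : ∃ C θ : ℝ, 0 ≤ C ∧ ∀ t, 0 ≤ t →
    |O.p₁ t - Real.cos (1 / 2 * x * t + θ)| ≤ C * Real.exp (-rate κ x * t) ∧
    |O.p₂ t - Real.sin (1 / 2 * x * t + θ)| ≤ C * Real.exp (-rate κ x * t) ∧
    |O.q₁ t| ≤ C * Real.exp (-rate κ x * t) ∧ |O.q₂ t| ≤ C * Real.exp (-rate κ x * t) ∧
    |O.v₁ t + 1 / 2 * x * Real.sin (1 / 2 * x * t + θ)| ≤ C * Real.exp (-rate κ x * t) ∧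
    |O.v₂ t - 1 / 2 * x * Real.cos (1 / 2 * x * t + θ)| ≤ C * Real.exp (-rate κ x * t) ∧
    |O.w₁ t| ≤ C * Real.exp (-rate κ x * t) ∧ |O.w₂ t| ≤ C * Real.exp (-rate κ x * t) := by
  obtain ⟨D, hD, hsD⟩ := O.exists_s_le hκ hx
  set ν := rate κ x with hνdef
  have hν : 0 < ν := rate_pos hx
  have hdef : ∀ t, |O.v₁ t + x / 2 * O.p₂ t| ≤ (ν + |x|) * O.s t ∧
      |O.v₂ t - x / 2 * O.p₁ t| ≤ (ν + |x|) * O.s t := by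
    intro t
    have h := O.abs_velocity_defect_le hκ hx t
    have h0 : 0 ≤ (ν + |x|) * O.s t := mul_nonneg (by positivity) (O.s_nonneg t)
    exact ⟨abs_le_of_sq_le_sq (by nlinarith [sq_nonneg (O.v₂ t - x / 2 * O.p₁ t)]) h0,
      abs_le_of_sq_le_sq (by nlinarith [sq_nonneg (O.v₁ t + x / 2 * O.p₂ t)]) h0⟩
  set D₁ := (ν + |x|) * D with hD₁def
  have hD₁ : 0 ≤ D₁ := by positivity
  have hdef' : ∀ t, |O.v₁ t + x / 2 * O.p₂ t| ≤ D₁ * Real.exp (-(2 * ν) * t) ∧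
      |O.v₂ t - x / 2 * O.p₁ t| ≤ D₁ * Real.exp (-(2 * ν) * t) := by
    intro t
    have h : (ν + |x|) * O.s t ≤ D₁ * Real.exp (-(2 * ν) * t) := by
      rw [hD₁def, mul_assoc]
      exact mul_le_mul_of_nonneg_left (hsD t) (by positivity)
    exact ⟨(hdef t).1.trans h, (hdef t).2.trans h⟩
  have hcos : ∀ t, HasDerivAt (fun t => Real.cos (x / 2 * t)) (-Real.sin (x / 2 * t) * (x / 2)) t :=
    fun t => by simpa using ((hasDerivAt_id t).const_mul (x / 2)).cos
  have hsin : ∀ t, HasDerivAt (fun t => Real.sin (x / 2 * t)) (Real.cos (x / 2 * t) * (x / 2)) t :=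
    fun t => by simpa using ((hasDerivAt_id t).const_mul (x / 2)).sin
  -- f₁ + i f₂ = (p₁ + i p₂)e^{-ixt/2}: the conformal part in the rotating frame, whose derivative
  -- is the rotated velocity defect.
  set f₁ : ℝ → ℝ := fun t => O.p₁ t * Real.cos (x / 2 * t) + O.p₂ t * Real.sin (x / 2 * t)
  set f₂ : ℝ → ℝ := fun t => O.p₂ t * Real.cos (x / 2 * t) - O.p₁ t * Real.sin (x / 2 * t)
  have hf₁ : ∀ t, HasDerivAt f₁ ((O.v₁ t + x / 2 * O.p₂ t) * Real.cos (x / 2 * t)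
      + (O.v₂ t - x / 2 * O.p₁ t) * Real.sin (x / 2 * t)) t := fun t =>
    (((O.hp₁ t).mul (hcos t)).add ((O.hp₂ t).mul (hsin t))).congr_deriv (by ring)
  have hf₂ : ∀ t, HasDerivAt f₂ ((O.v₂ t - x / 2 * O.p₁ t) * Real.cos (x / 2 * t)
      - (O.v₁ t + x / 2 * O.p₂ t) * Real.sin (x / 2 * t)) t := fun t =>
    (((O.hp₂ t).mul (hcos t)).sub ((O.hp₁ t).mul (hsin t))).congr_deriv (by ring)
  have hmul : ∀ a b M : ℝ, |a| ≤ M → |b| ≤ 1 → |a * b| ≤ M := fun a b M ha hb => by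
    rw [abs_mul]
    exact (mul_le_of_le_one_right (abs_nonneg a) hb).trans ha
  obtain ⟨L₁, hL₁⟩ := exists_limit_of_deriv_le_exp (C := 2 * D₁) (a := 2 * ν) (by positivity) hf₁
    fun t _ => by
      have h1 := hmul _ _ _ (hdef' t).1 (Real.abs_cos_le_one (x / 2 * t))
      have h2 := hmul _ _ _ (hdef' t).2 (Real.abs_sin_le_one (x / 2 * t))
      exact (abs_add_le _ _).trans (by linarith)
  obtain ⟨L₂, hL₂⟩ := exists_limit_of_deriv_le_exp (C := 2 * D₁) (a := 2 * ν) (by positivity) hf₂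
    fun t _ => by
      have h1 := hmul _ _ _ (hdef' t).2 (Real.abs_cos_le_one (x / 2 * t))
      have h2 := hmul _ _ _ (hdef' t).1 (Real.abs_sin_le_one (x / 2 * t))
      exact (abs_sub _ _).trans (by linarith)
  set M := 2 * D₁ / (2 * ν) with hMdef
  have hM : 0 ≤ M := by positivity
  have hexp : Tendsto (fun t : ℝ => Real.exp (-(2 * ν) * t)) atTop (𝓝 0) :=
    Real.tendsto_exp_atBot.comp (tendsto_id.const_mul_atTop_of_neg (by linarith))
  have hlim : ∀ (f : ℝ → ℝ) (L : ℝ),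
      (∀ t, 0 ≤ t → |f t - L| ≤ M * Real.exp (-(2 * ν) * t)) → Tendsto f atTop (𝓝 L) := by
    intro f L h
    rw [tendsto_iff_norm_sub_tendsto_zero]
    have hz := hexp.const_mul M
    rw [mul_zero] at hz
    exact squeeze_zero' (Eventually.of_forall fun t => norm_nonneg _)
      ((eventually_ge_atTop 0).mono h) hz
  have hs0 : Tendsto O.s atTop (𝓝 0) :=
    squeeze_zero O.s_nonneg hsD (by simpa using hexp.const_mul D)
  -- Rotation preserves length, so |f|² = |p|² = 1 + s tends to 1.
  have hunit : L₁ ^ 2 + L₂ ^ 2 = 1 := by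
    have h1 := ((hlim f₁ L₁ hL₁).pow 2).add ((hlim f₂ L₂ hL₂).pow 2)
    have h2 : Tendsto (fun t => 1 + O.s t) atTop (𝓝 (1 + 0)) := hs0.const_add 1
    have e : (fun t => f₁ t ^ 2 + f₂ t ^ 2) = fun t => 1 + O.s t := by
      funext t
      have h3 := O.det_eq t
      have h4 := Real.sin_sq_add_cos_sq (x / 2 * t)
      simp only [f₁, f₂, s]
      linear_combination (O.p₁ t ^ 2 + O.p₂ t ^ 2) * h4 + h3
    rw [e] at h1
    simpa using tendsto_nhds_unique h1 h2
  obtain ⟨θ, hθ₁, hθ₂⟩ : ∃ θ, Real.cos θ = L₁ ∧ Real.sin θ = L₂ := by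
    have hn : ‖(⟨L₁, L₂⟩ : ℂ)‖ = 1 := by
      rw [Complex.norm_def, Complex.normSq_mk, Real.sqrt_eq_one]; linarith
    have hne : (⟨L₁, L₂⟩ : ℂ) ≠ 0 := by rw [← norm_ne_zero_iff, hn]; exact one_ne_zero
    refine ⟨Complex.arg ⟨L₁, L₂⟩, ?_, ?_⟩
    · rw [Complex.cos_arg hne, hn, div_one]
    · rw [Complex.sin_arg, hn, div_one]
  have hexple : ∀ t, 0 ≤ t → Real.exp (-(2 * ν) * t) ≤ Real.exp (-ν * t) := fun t ht =>
    Real.exp_le_exp.2 (by nlinarith)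
  have hp : ∀ t, 0 ≤ t → |O.p₁ t - Real.cos (1 / 2 * x * t + θ)| ≤ 2 * M * Real.exp (-ν * t) ∧
      |O.p₂ t - Real.sin (1 / 2 * x * t + θ)| ≤ 2 * M * Real.exp (-ν * t) := by
    intro t ht
    have e1 : 1 / 2 * x * t + θ = x / 2 * t + θ := by ring
    have h4 := Real.sin_sq_add_cos_sq (x / 2 * t)
    have hm : M * Real.exp (-(2 * ν) * t) ≤ M * Real.exp (-ν * t) :=
      mul_le_mul_of_nonneg_left (hexple t ht) hM
    rw [e1, Real.cos_add, Real.sin_add, hθ₁, hθ₂]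
    have a1 := hmul _ _ _ (hL₁ t ht) (Real.abs_cos_le_one (x / 2 * t))
    have a2 := hmul _ _ _ (hL₂ t ht) (Real.abs_sin_le_one (x / 2 * t))
    have a3 := hmul _ _ _ (hL₁ t ht) (Real.abs_sin_le_one (x / 2 * t))
    have a4 := hmul _ _ _ (hL₂ t ht) (Real.abs_cos_le_one (x / 2 * t))
    constructor
    · have e : O.p₁ t - (Real.cos (x / 2 * t) * L₁ - Real.sin (x / 2 * t) * L₂) =
          (f₁ t - L₁) * Real.cos (x / 2 * t) - (f₂ t - L₂) * Real.sin (x / 2 * t) := by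
        simp only [f₁, f₂]; linear_combination (-O.p₁ t) * h4
      rw [e]
      exact (abs_sub _ _).trans (by linarith)
    · have e : O.p₂ t - (Real.sin (x / 2 * t) * L₁ + Real.cos (x / 2 * t) * L₂) =
          (f₁ t - L₁) * Real.sin (x / 2 * t) + (f₂ t - L₂) * Real.cos (x / 2 * t) := by
        simp only [f₁, f₂]; linear_combination (-O.p₂ t) * h4
      rw [e]
      exact (abs_add_le _ _).trans (by linarith)
  -- Passing from s to |q| = √s halves the exponent; this is why the overall rate is ν and not 2ν.
  have hsq : ∀ t, O.s t ≤ (Real.sqrt D * Real.exp (-ν * t)) ^ 2 := by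
    intro t
    rw [mul_pow, Real.sq_sqrt hD, ← Real.exp_nat_mul]
    refine (hsD t).trans_eq ?_
    congr 2; push_cast; ring
  have hw := O.w_sq_le hκ hx
  -- The summands serve `p`, `q`, `v` and `w` in turn; their sum is one constant for all eight
  -- bounds.
  refine ⟨2 * M + Real.sqrt D + (D₁ + |x| * M) + ν * Real.sqrt D, θ, by positivity,
    fun t ht => ?_⟩
  obtain ⟨hp1, hp2⟩ := hp t ht
  obtain ⟨hd1, hd2⟩ := hdef' t
  set E := Real.exp (-ν * t) with hE
  have hE0 : 0 < E := Real.exp_pos _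
  have b1 : 0 ≤ M * E := by positivity
  have b2 : 0 ≤ Real.sqrt D * E := by positivity
  have b3 : 0 ≤ D₁ * E := by positivity
  have b4 : 0 ≤ |x| * (M * E) := by positivity
  have b5 : 0 ≤ ν * (Real.sqrt D * E) := by positivity
  have hb : D₁ * Real.exp (-(2 * ν) * t) ≤ D₁ * E :=
    mul_le_mul_of_nonneg_left (hexple t ht) hD₁
  have hst := hsq t
  have hst' : O.q₁ t ^ 2 + O.q₂ t ^ 2 ≤ (Real.sqrt D * E) ^ 2 := hst
  have hwt : O.w₁ t ^ 2 + O.w₂ t ^ 2 ≤ (ν * (Real.sqrt D * E)) ^ 2 := by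
    rw [mul_pow ν]
    exact (hw t).trans (mul_le_mul_of_nonneg_left hst (by positivity))
  have hscale : ∀ a : ℝ, |a| ≤ 2 * M * E → |x / 2 * a| ≤ |x| * (M * E) := by
    intro a ha
    rw [abs_mul, abs_div, abs_two]
    nlinarith [mul_le_mul_of_nonneg_left ha (abs_nonneg x)]
  refine ⟨by linarith, by linarith, ?_, ?_, ?_, ?_, ?_, ?_⟩
  · have := abs_le_of_sq_le_sq (by linarith [sq_nonneg (O.q₂ t)]) b2 (a := O.q₁ t)
    linarith
  · have := abs_le_of_sq_le_sq (by linarith [sq_nonneg (O.q₁ t)]) b2 (a := O.q₂ t)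
    linarith
  · have e : O.v₁ t + 1 / 2 * x * Real.sin (1 / 2 * x * t + θ) = (O.v₁ t + x / 2 * O.p₂ t)
        - x / 2 * (O.p₂ t - Real.sin (1 / 2 * x * t + θ)) := by ring
    rw [e]
    have := hscale _ hp2
    exact (abs_sub _ _).trans (by linarith)
  · have e : O.v₂ t - 1 / 2 * x * Real.cos (1 / 2 * x * t + θ) = (O.v₂ t - x / 2 * O.p₁ t)
        + x / 2 * (O.p₁ t - Real.cos (1 / 2 * x * t + θ)) := by ring
    rw [e]
    have := hscale _ hp1
    exact (abs_add_le _ _).trans (by linarith)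
  · have := abs_le_of_sq_le_sq (by linarith [sq_nonneg (O.w₂ t)]) b5 (a := O.w₁ t)
    linarith
  · have := abs_le_of_sq_le_sq (by linarith [sq_nonneg (O.w₁ t)]) b5 (a := O.w₂ t)
    linarith

end ReducedOrbit

end AffineMHD
-- Matrix quantities in terms of entries.
namespace AffineMHD

theorem ip_eq (A B : Mat) :
    ip A B = A 0 0 * B 0 0 + A 0 1 * B 0 1 + A 1 0 * B 1 0 + A 1 1 * B 1 1 := by
  simp [ip, Fin.sum_univ_two]; ring

theorem norm_sq_eq (A : Mat) :
    ‖A‖ ^ 2 = A 0 0 ^ 2 + A 0 1 ^ 2 + A 1 0 ^ 2 + A 1 1 ^ 2 := by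
  have h : 0 ≤ A 0 0 ^ 2 + A 0 1 ^ 2 + (A 1 0 ^ 2 + A 1 1 ^ 2) := by positivity
  rw [Matrix.frobenius_norm_def, ← Real.sqrt_eq_rpow]
  simp only [Fin.sum_univ_two, Real.rpow_two, Real.norm_eq_abs, sq_abs]
  rw [Real.sq_sqrt h]; ring

theorem cof_eq (A : Mat) : cof A = !![A 1 1, -A 1 0; -A 0 1, A 0 0] := by
  rw [cof, Matrix.adjugate_fin_two]
  ext i j; fin_cases i <;> fin_cases j <;> rfl

theorem X₁_eq (κ : ℝ) (A B : Mat) : X₁ κ A B =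
    1 / 2 * (B 0 0 ^ 2 + B 0 1 ^ 2 + B 1 0 ^ 2 + B 1 1 ^ 2) +
      κ / 2 * (A 0 0 ^ 2 + A 0 1 ^ 2 + A 1 0 ^ 2 + A 1 1 ^ 2) := by
  rw [X₁, norm_sq_eq, norm_sq_eq]

theorem X₂_eq (A B : Mat) : X₂ A B =
    1 / 2 * ((A 0 0 - A 1 1) * (B 1 0 + B 0 1) - (A 1 0 + A 0 1) * (B 0 0 - B 1 1)) := by
  simp only [X₂, ip_eq, Z, Matrix.sub_apply, Matrix.mul_apply, Fin.sum_univ_two]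
  simp; ring

theorem X₃_eq (A B : Mat) : X₃ A B =
    1 / 2 * ((A 0 0 + A 1 1) * (B 1 0 - B 0 1) - (A 1 0 - A 0 1) * (B 0 0 + B 1 1)) := by
  simp only [X₃, ip_eq, Z, Matrix.add_apply, Matrix.mul_apply, Fin.sum_univ_two]
  simp; ring

theorem ip_cof_eq (A B : Mat) :
    ip B (cof A) = B 0 0 * A 1 1 - B 0 1 * A 1 0 - B 1 0 * A 0 1 + B 1 1 * A 0 0 := by
  rw [ip_eq, cof_eq]; simp; ring

/-- Explicit form of membership in `𝒲(x)`. -/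
theorem mem_W_iff {κ x : ℝ} {A B : Mat} : (A, B) ∈ W κ x ↔
    (A 0 0 * A 1 1 - A 0 1 * A 1 0 = 1 ∧
      B 0 0 * A 1 1 - B 0 1 * A 1 0 - B 1 0 * A 0 1 + B 1 1 * A 0 0 = 0) ∧
    1 / 2 * (B 0 0 ^ 2 + B 0 1 ^ 2 + B 1 0 ^ 2 + B 1 1 ^ 2) +
      κ / 2 * (A 0 0 ^ 2 + A 0 1 ^ 2 + A 1 0 ^ 2 + A 1 1 ^ 2) = κ + 1 / 4 * x ^ 2 ∧
    1 / 2 * ((A 0 0 - A 1 1) * (B 1 0 + B 0 1) - (A 1 0 + A 0 1) * (B 0 0 - B 1 1)) = 0 ∧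
    1 / 2 * ((A 0 0 + A 1 1) * (B 1 0 - B 0 1) - (A 1 0 - A 0 1) * (B 0 0 + B 1 1)) = x := by
  rw [← X₁_eq, ← X₂_eq, ← X₃_eq, ← ip_cof_eq, ← Matrix.det_fin_two]
  rfl

theorem isRotation_iff {A : Mat} (hA : A.det = 1) :
    IsRotation A ↔ A 0 0 = A 1 1 ∧ A 1 0 = -A 0 1 := by
  rw [IsRotation, Matrix.mem_specialOrthogonalGroup_iff, Matrix.mem_orthogonalGroup_iff]
  rw [Matrix.det_fin_two] at hA
  constructor
  · rintro ⟨h, -⟩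
    have h00 := congrFun (congrFun h 0) 0
    have h11 := congrFun (congrFun h 1) 1
    simp [Matrix.mul_apply, Fin.sum_univ_two] at h00 h11
    -- This is |A|² - 2 det A, and orthogonality gives |A|² = 2.
    have e : (A 0 0 - A 1 1) ^ 2 + (A 1 0 + A 0 1) ^ 2 = 0 := by nlinarith
    constructor
    · nlinarith [sq_nonneg (A 0 0 - A 1 1), sq_nonneg (A 1 0 + A 0 1)]
    · nlinarith [sq_nonneg (A 0 0 - A 1 1), sq_nonneg (A 1 0 + A 0 1)]
  · rintro ⟨h1, h2⟩
    refine ⟨?_, by rw [Matrix.det_fin_two]; exact hA⟩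
    rw [h1, h2] at hA
    ext i j
    fin_cases i <;> fin_cases j <;>
      simp [Matrix.mul_apply, Fin.sum_univ_two, h1, h2] <;> linarith

theorem hasDerivAt_entry {A : ℝ → Mat} {A' : Mat} {t : ℝ} (h : HasDerivAt A A' t) (i j : Fin 2) :
    HasDerivAt (fun t => A t i j) (A' i j) t :=
  (LinearMap.toContinuousLinearMap (Matrix.entryLinearMap ℝ ℝ i j)).hasFDerivAt.comp_hasDerivAt t h

theorem hasDerivAt_of_entries {A : ℝ → Mat} {A' : Mat} {t : ℝ}
    (h : ∀ i j, HasDerivAt (fun t => A t i j) (A' i j) t) : HasDerivAt A A' t := by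
  have e : ∀ B : Mat, B = ∑ i, ∑ j, B i j • Matrix.single i j (1 : ℝ) := fun B => by
    conv_lhs => rw [Matrix.matrix_eq_sum_single B]
    simp [Matrix.smul_single]
  have h2 : HasDerivAt (fun t => ∑ i, ∑ j, A t i j • Matrix.single i j (1 : ℝ))
      (∑ i, ∑ j, A' i j • Matrix.single i j (1 : ℝ)) t :=
    HasDerivAt.fun_sum fun i _ => HasDerivAt.fun_sum fun j _ => (h i j).smul_const _
  rw [← e A'] at h2
  exact h2.congr_of_eventuallyEq (Eventually.of_forall fun t => e (A t))

theorem norm_le_of_entries {A : Mat} {M : ℝ} (h : ∀ i j, |A i j| ≤ M) : ‖A‖ ≤ 2 * M := by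
  have hM : 0 ≤ M := (abs_nonneg _).trans (h 0 0)
  refine le_of_sq_le_sq ?_ (by positivity)
  rw [norm_sq_eq]
  have := fun i j => sq_le_sq' (abs_le.1 (h i j)).1 (abs_le.1 (h i j)).2
  linarith [this 0 0, this 0 1, this 1 0, this 1 1]

theorem hasDerivAt_U (a b t : ℝ) :
    HasDerivAt (fun t => U (a * t + b)) (a • (Z * U (a * t + b))) t := by
  have hl : HasDerivAt (fun t => a * t + b) a t := by
    simpa using ((hasDerivAt_id t).const_mul a).add_const b
  refine hasDerivAt_of_entries fun i j => ?_
  fin_cases i <;> fin_cases j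
  · simpa [U, Z, mul_comm] using hl.cos
  · simpa [U, Z, mul_comm] using hl.sin.fun_neg
  · simpa [U, Z, mul_comm] using hl.sin
  · simpa [U, Z, mul_comm] using hl.cos

/-! ### Conservation laws, reduction to `ReducedOrbit`, and time reversal. -/

namespace IsSolution

variable {κ : ℝ} {A : ℝ → Mat} (hA : IsSolution κ A)
include hA

theorem hasDerivAt (t : ℝ) : HasDerivAt A (deriv A t) t :=
  (hA.1.differentiable (by norm_num) t).hasDerivAt

theorem hasDerivAt_deriv (t : ℝ) : HasDerivAt (deriv A) (deriv (deriv A) t) t := by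
  have h : ContDiff ℝ (1 + 1) A := by simpa [one_add_one_eq_two] using hA.1
  have h2 := (contDiff_succ_iff_deriv.1 h).2.2
  exact (h2.differentiable (by norm_num) t).hasDerivAt

/-- The equation of motion, entry by entry. -/
theorem exists_entries : ∃ lam : ℝ → ℝ, ∀ t,
    HasDerivAt (fun t => deriv A t 0 0) (lam t * A t 1 1 - κ * A t 0 0) t ∧
    HasDerivAt (fun t => deriv A t 0 1) (-(lam t * A t 1 0) - κ * A t 0 1) t ∧
    HasDerivAt (fun t => deriv A t 1 0) (-(lam t * A t 0 1) - κ * A t 1 0) t ∧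
    HasDerivAt (fun t => deriv A t 1 1) (lam t * A t 0 0 - κ * A t 1 1) t := by
  obtain ⟨lam, -, h⟩ := hA.2.2
  refine ⟨lam, fun t => ?_⟩
  have e : deriv (deriv A) t = lam t • cof (A t) - κ • A t := by rw [← h t]; abel
  have hd := hasDerivAt_entry (hA.hasDerivAt_deriv t)
  rw [e, cof_eq] at hd
  refine ⟨?_, ?_, ?_, ?_⟩
  · simpa using hd 0 0
  · simpa using hd 0 1
  · simpa using hd 1 0
  · simpa using hd 1 1

theorem det_eq (t : ℝ) : A t 0 0 * A t 1 1 - A t 0 1 * A t 1 0 = 1 := by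
  rw [← Matrix.det_fin_two]; exact hA.2.1 t

theorem tangent (t : ℝ) : deriv A t 0 0 * A t 1 1 - deriv A t 0 1 * A t 1 0
    - deriv A t 1 0 * A t 0 1 + deriv A t 1 1 * A t 0 0 = 0 := by
  have hd := hasDerivAt_entry (hA.hasDerivAt t)
  have h := ((hd 0 0).mul (hd 1 1)).sub ((hd 0 1).mul (hd 1 0))
  have h2 : HasDerivAt ((fun t => A t 0 0) * (fun t => A t 1 1) -
      (fun t => A t 0 1) * fun t => A t 1 0) 0 t := by
    have e : ((fun t => A t 0 0) * (fun t => A t 1 1) -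
      (fun t => A t 0 1) * fun t => A t 1 0) = fun _ => (1 : ℝ) := by
      funext t; exact hA.det_eq t
    rw [e]; exact hasDerivAt_const t 1
  linear_combination h.unique h2

/-- The set `𝒲(x)` is invariant. -/
theorem mem_W {x s : ℝ} (t : ℝ) (h : (A s, deriv A s) ∈ W κ x) : (A t, deriv A t) ∈ W κ x := by
  obtain ⟨lam, hl⟩ := hA.exists_entries
  have hd := fun t => hasDerivAt_entry (hA.hasDerivAt t)
  have hconst : ∀ f : ℝ → ℝ, (∀ t, HasDerivAt f 0 t) → f t = f s := fun f hf =>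
    is_const_of_deriv_eq_zero (fun t => (hf t).differentiableAt) (fun t => (hf t).deriv) t s
  have h1 : X₁ κ (A t) (deriv A t) = X₁ κ (A s) (deriv A s) := by
    refine hconst (fun t => X₁ κ (A t) (deriv A t)) fun t => ?_
    simp only [X₁_eq]
    obtain ⟨h00, h01, h10, h11⟩ := hl t
    have hh := (((((h00.fun_pow 2).fun_add (h01.fun_pow 2)).fun_add (h10.fun_pow 2)).fun_add
      (h11.fun_pow 2)).const_mul (1 / 2)).fun_add
      ((((((hd t 0 0).fun_pow 2).fun_add ((hd t 0 1).fun_pow 2)).fun_add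
        ((hd t 1 0).fun_pow 2)).fun_add ((hd t 1 1).fun_pow 2)).const_mul (κ / 2))
    refine hh.congr_deriv ?_
    push_cast
    -- The derivative of the energy is λ⟨cof A, A'⟩, which the tangency condition annihilates.
    linear_combination lam t * hA.tangent t
  -- Conservation of angular momentum of a central force: the terms in `lam t` and κ cancel
  -- identically, without the constraint.
  have h2 : X₂ (A t) (deriv A t) = X₂ (A s) (deriv A s) := by
    refine hconst (fun t => X₂ (A t) (deriv A t)) fun t => ?_
    simp only [X₂_eq]
    obtain ⟨h00, h01, h10, h11⟩ := hl t
    have hh := ((((hd t 0 0).fun_sub (hd t 1 1)).fun_mul (h10.fun_add h01)).fun_sub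
      (((hd t 1 0).fun_add (hd t 0 1)).fun_mul (h00.fun_sub h11))).const_mul (1 / 2)
    refine hh.congr_deriv ?_
    ring
  have h3 : X₃ (A t) (deriv A t) = X₃ (A s) (deriv A s) := by
    refine hconst (fun t => X₃ (A t) (deriv A t)) fun t => ?_
    simp only [X₃_eq]
    obtain ⟨h00, h01, h10, h11⟩ := hl t
    have hh := ((((hd t 0 0).fun_add (hd t 1 1)).fun_mul (h10.fun_sub h01)).fun_sub
      (((hd t 1 0).fun_sub (hd t 0 1)).fun_mul (h00.fun_add h11))).const_mul (1 / 2)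
    refine hh.congr_deriv ?_
    ring
  refine ⟨⟨hA.2.1 t, ?_⟩, h1.trans h.2.1, h2.trans h.2.2.1, h3.trans h.2.2.2⟩
  rw [ip_cof_eq]; exact hA.tangent t

/-- The conformal and anticonformal parts of a solution with data in `𝒲(x)`. -/
theorem exists_reducedOrbit {x : ℝ} (h : (A 0, deriv A 0) ∈ W κ x) :
    ∃ O : ReducedOrbit κ x,
      O.p₁ = (fun t => (A t 0 0 + A t 1 1) / 2) ∧ O.p₂ = (fun t => (A t 1 0 - A t 0 1) / 2) ∧
      O.q₁ = (fun t => (A t 0 0 - A t 1 1) / 2) ∧ O.q₂ = (fun t => (A t 1 0 + A t 0 1) / 2) ∧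
      O.v₁ = (fun t => (deriv A t 0 0 + deriv A t 1 1) / 2) ∧
      O.v₂ = (fun t => (deriv A t 1 0 - deriv A t 0 1) / 2) ∧
      O.w₁ = (fun t => (deriv A t 0 0 - deriv A t 1 1) / 2) ∧
      O.w₂ = (fun t => (deriv A t 1 0 + deriv A t 0 1) / 2) := by
  obtain ⟨lam, hl⟩ := hA.exists_entries
  have hd := fun t => hasDerivAt_entry (hA.hasDerivAt t)
  have hW := fun t => mem_W_iff.1 (hA.mem_W t h)
  refine ⟨{ p₁ := _, p₂ := _, q₁ := _, q₂ := _, v₁ := _, v₂ := _, w₁ := _, w₂ := _, lam := lam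
            hp₁ := fun t => ((hd t 0 0).fun_add (hd t 1 1)).div_const 2
            hp₂ := fun t => ((hd t 1 0).fun_sub (hd t 0 1)).div_const 2
            hq₁ := fun t => ((hd t 0 0).fun_sub (hd t 1 1)).div_const 2
            hq₂ := fun t => ((hd t 1 0).fun_add (hd t 0 1)).div_const 2
            hv₁ := fun t => (((hl t).1.fun_add (hl t).2.2.2).div_const 2).congr_deriv (by ring)
            hv₂ := fun t => (((hl t).2.2.1.fun_sub (hl t).2.1).div_const 2).congr_deriv (by ring)
            hw₁ := fun t => (((hl t).1.fun_sub (hl t).2.2.2).div_const 2).congr_deriv (by ring)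
            hw₂ := fun t => (((hl t).2.2.1.fun_add (hl t).2.1).div_const 2).congr_deriv (by ring)
            det_eq := fun t => ?_
            tangent := fun t => ?_
            energy := fun t => ?_
            momentum_p := fun t => ?_
            momentum_q := fun t => ?_ }, rfl, rfl, rfl, rfl, rfl, rfl, rfl, rfl⟩ <;>
    obtain ⟨⟨h1, h2⟩, h3, h4, h5⟩ := hW t
  · linear_combination h1
  · linear_combination 1 / 2 * h2
  · linear_combination h3 - κ * h1
  · linear_combination 1 / 2 * h5
  · linear_combination 1 / 2 * h4

/-- Solutions are invariant under time reversal. -/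
theorem comp_neg : IsSolution κ (fun t => A (-t)) := by
  obtain ⟨h1, h2, lam, h3, h4⟩ := hA
  refine ⟨h1.comp contDiff_neg, fun t => h2 (-t), fun t => lam (-t), h3.comp continuous_neg,
    fun t => ?_⟩
  have e : deriv (fun t => A (-t)) = fun t => -deriv A (-t) := by
    funext t; exact deriv_comp_neg A t
  have e2 : deriv (fun t => -deriv A (-t)) t = deriv (deriv A) (-t) := by
    have h5 := ((hasDerivAt_deriv ⟨h1, h2, lam, h3, h4⟩ (-t)).scomp t (hasDerivAt_neg t)).neg
    rw [neg_smul, one_smul, neg_neg] at h5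
    exact h5.deriv
  rw [e, e2]
  exact h4 (-t)

-- Reversing the velocity keeps `X₁` and flips the signs of `X₂` and `X₃`. As X₂ = 0 and the
-- condition on x involves only x², every forward statement yields a backward one.
omit hA in
theorem mem_W_comp_neg {x t : ℝ} (h : (A (-t), deriv A (-t)) ∈ W κ x) :
    (A (-t), deriv (fun t => A (-t)) t) ∈ W κ (-x) := by
  have e : deriv (fun t => A (-t)) t = -deriv A (-t) := deriv_comp_neg A t
  rw [e]
  rw [mem_W_iff] at h ⊢
  obtain ⟨⟨h1, h2⟩, h3, h4, h5⟩ := h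
  simp only [Matrix.neg_apply]
  refine ⟨⟨h1, ?_⟩, ?_, ?_, ?_⟩
  · linear_combination -h2
  · linear_combination h3
  · linear_combination -h4
  · linear_combination -h5

end IsSolution

end AffineMHD
-- The turning point, and the asymptotics of matrix solutions.
namespace AffineMHD

/-- A point of `𝒲(x)` off the rotation group: the turning point of the homoclinic orbits. -/
theorem exists_mem_W_not_isRotation {κ x : ℝ} (hκ : 0 < κ) (hx : 8 * κ < x ^ 2) :
    ∃ P ∈ W κ x, ¬ IsRotation P.1 := by
  have hc : 1 < x ^ 2 / (8 * κ) := by rw [lt_div_iff₀ (by positivity)]; linarith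
  -- c = |p| and d = |q| at the turning point r = 0, where `r_sq` gives s = ν²/(2κ) = x²/(8κ) - 1.
  -- There w = 0, and p×v = x/2 fixes the velocity.
  obtain ⟨c, hc0, hc2⟩ : ∃ c : ℝ, 0 < c ∧ c ^ 2 = x ^ 2 / (8 * κ) :=
    ⟨Real.sqrt (x ^ 2 / (8 * κ)), Real.sqrt_pos.2 (by linarith), Real.sq_sqrt (by linarith)⟩
  obtain ⟨d, hd0, hd2⟩ : ∃ d : ℝ, 0 < d ∧ d ^ 2 = x ^ 2 / (8 * κ) - 1 :=
    ⟨Real.sqrt (x ^ 2 / (8 * κ) - 1), Real.sqrt_pos.2 (by linarith), Real.sq_sqrt (by linarith)⟩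
  have hcx : x ^ 2 = 8 * κ * c ^ 2 := by rw [hc2]; field_simp
  have hmem : (!![c + d, 0; 0, c - d], !![0, -(x / (2 * c)); x / (2 * c), 0]) ∈ W κ x := by
    rw [mem_W_iff]
    have hxc : (x / (2 * c)) ^ 2 = 2 * κ := by rw [div_pow, hcx]; field_simp; norm_num
    refine ⟨⟨?_, ?_⟩, ?_, ?_, ?_⟩ <;> simp
    · linear_combination hc2 - hd2
    · linear_combination hxc - 1 / 4 * hcx + κ * (hd2 - hc2)
    · field_simp
      ring
  refine ⟨_, hmem, ?_⟩
  rw [isRotation_iff hmem.1.1]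
  rintro ⟨h, -⟩
  simp at h
  linarith

/-- ⟨A, A'⟩ = 2(p·v + q·w), and the tangency condition makes both products equal to r. Rotations are
the matrices of determinant one with q = 0. -/
theorem ip_eq_of_orbit {κ x : ℝ} {A : ℝ → Mat} (hA : IsSolution κ A)
    (h : (A 0, deriv A 0) ∈ W κ x) : ∃ O : ReducedOrbit κ x,
      (∀ t, ip (A t) (deriv A t) = 4 * O.r t) ∧ ∀ t, IsRotation (A t) ↔ O.s t = 0 := by
  obtain ⟨O, hp₁, hp₂, hq₁, hq₂, hv₁, hv₂, hw₁, hw₂⟩ := hA.exists_reducedOrbit h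
  refine ⟨O, fun t => ?_, fun t => ?_⟩
  · have ht := O.tangent t
    rw [hp₁, hp₂, hq₁, hq₂, hv₁, hv₂, hw₁, hw₂] at ht
    rw [ip_eq, ReducedOrbit.r, hq₁, hq₂, hw₁, hw₂]
    linear_combination 2 * ht
  · rw [isRotation_iff (hA.2.1 t), ReducedOrbit.s, hq₁, hq₂]
    constructor
    · rintro ⟨h1, h2⟩
      simp [h1, h2]
    · intro h1
      constructor <;>
        nlinarith [sq_nonneg (A t 0 0 - A t 1 1), sq_nonneg (A t 1 0 + A t 0 1)]

namespace IsSolution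

variable {κ x : ℝ} {A : ℝ → Mat} (hA : IsSolution κ A) (hκ : 0 < κ) (hx : 8 * κ < x ^ 2)
include hA hκ hx

theorem not_isRotation {t₀ : ℝ} (h : (A 0, deriv A 0) ∈ W κ x) (h₀ : ¬ IsRotation (A t₀)) (t : ℝ) :
    ¬ IsRotation (A t) := by
  obtain ⟨O, -, hO⟩ := ip_eq_of_orbit hA h
  rw [hO] at h₀ ⊢
  exact (O.s_pos hκ hx ((O.s_nonneg t₀).lt_of_ne' h₀) t).ne'

theorem exists_ip_neg (h : (A 0, deriv A 0) ∈ W κ x) (h₀ : ¬ IsRotation (A 0)) :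
    ∃ T, 0 < T ∧ ∀ t, T < t → ip (A t) (deriv A t) < 0 := by
  obtain ⟨O, hip, hO⟩ := ip_eq_of_orbit hA h
  rw [hO] at h₀
  obtain ⟨T, hT, hr⟩ := O.exists_r_neg hκ hx ((O.s_nonneg 0).lt_of_ne' h₀)
  exact ⟨T, hT, fun t ht => by rw [hip]; linarith [hr t ht]⟩

theorem exists_ip_pos (h : (A 0, deriv A 0) ∈ W κ x) (h₀ : ¬ IsRotation (A 0)) :
    ∃ T, 0 < T ∧ ∀ t, t < -T → 0 < ip (A t) (deriv A t) := by
  have hW : (A (-0), deriv (fun t => A (-t)) 0) ∈ W κ (-x) :=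
    mem_W_comp_neg (by rwa [neg_zero])
  obtain ⟨T, hT, hr⟩ := hA.comp_neg.exists_ip_neg hκ (by rwa [neg_sq]) hW (by rwa [neg_zero])
  refine ⟨T, hT, fun t ht => ?_⟩
  have h1 := hr (-t) (by linarith)
  have e : deriv (fun t => A (-t)) (-t) = -deriv A (- -t) := deriv_comp_neg A (-t)
  rw [e, neg_neg, ip_eq] at h1
  rw [ip_eq]
  simp only [Matrix.neg_apply] at h1
  linarith

/-- Exponential convergence to a rigid rotation in forward time, at the sharp rate. -/
theorem exists_asymptotics_atTop (h : (A 0, deriv A 0) ∈ W κ x) :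
    ∃ C θ : ℝ, ∀ t, 0 ≤ t →
      ‖A t - U (1 / 2 * x * t + θ)‖ ≤ C * Real.exp (-rate κ x * t) ∧
      ‖deriv A t - (1 / 2 * x) • (Z * U (1 / 2 * x * t + θ))‖ ≤ C * Real.exp (-rate κ x * t) := by
  obtain ⟨O, hp₁, hp₂, hq₁, hq₂, hv₁, hv₂, hw₁, hw₂⟩ := hA.exists_reducedOrbit h
  obtain ⟨C, θ, hC, hO⟩ := O.exists_asymptotics hκ hx
  -- One factor 2 because each entry combines a component of `p` with one of `q`, another from
  -- `norm_le_of_entries`.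
  refine ⟨4 * C, θ, fun t ht => ?_⟩
  obtain ⟨h1, h2, h3, h4, h5, h6, h7, h8⟩ := hO t ht
  rw [hp₁, abs_le] at h1
  rw [hp₂, abs_le] at h2
  rw [hq₁, abs_le] at h3
  rw [hq₂, abs_le] at h4
  rw [hv₁, abs_le] at h5
  rw [hv₂, abs_le] at h6
  rw [hw₁, abs_le] at h7
  rw [hw₂, abs_le] at h8
  have e : 4 * C * Real.exp (-rate κ x * t) = 2 * (2 * (C * Real.exp (-rate κ x * t))) := by ring
  rw [e]
  constructor
  · refine norm_le_of_entries fun i j => abs_le.2 ?_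
    fin_cases i <;> fin_cases j <;> simp only [U, Matrix.sub_apply] <;>
      simp <;> simp at h1 h2 h3 h4 <;> constructor <;> linarith
  · refine norm_le_of_entries fun i j => abs_le.2 ?_
    fin_cases i <;> fin_cases j <;> simp only [U, Z, Matrix.sub_apply] <;>
      simp <;> simp at h5 h6 h7 h8 <;> constructor <;> linarith

/-- Exponential convergence to a rigid rotation in backward time, at the sharp rate. -/
theorem exists_asymptotics_atBot (h : (A 0, deriv A 0) ∈ W κ x) :
    ∃ C θ : ℝ, ∀ t, t ≤ 0 →
      ‖A t - U (1 / 2 * x * t + θ)‖ ≤ C * Real.exp (rate κ x * t) ∧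
      ‖deriv A t - (1 / 2 * x) • (Z * U (1 / 2 * x * t + θ))‖ ≤ C * Real.exp (rate κ x * t) := by
  have hW : (A (-0), deriv (fun t => A (-t)) 0) ∈ W κ (-x) :=
    mem_W_comp_neg (by rwa [neg_zero])
  obtain ⟨C, θ, hr⟩ := hA.comp_neg.exists_asymptotics_atTop hκ (by rwa [neg_sq]) hW
  refine ⟨C, θ, fun t ht => ?_⟩
  obtain ⟨h1, h2⟩ := hr (-t) (by linarith)
  have e : deriv (fun t => A (-t)) (-t) = -deriv A (- -t) := deriv_comp_neg A (-t)
  have e1 : 1 / 2 * -x * -t + θ = 1 / 2 * x * t + θ := by ring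
  have e2 : -rate κ (-x) * -t = rate κ x * t := by simp [rate]
  rw [e1, e2, neg_neg] at h1
  rw [e, e1, e2, neg_neg, ← norm_neg] at h2
  refine ⟨h1, ?_⟩
  have e3 : deriv A t - (1 / 2 * x) • (Z * U (1 / 2 * x * t + θ)) =
      -(-deriv A t - (1 / 2 * -x) • (Z * U (1 / 2 * x * t + θ))) := by
    rw [mul_neg, neg_smul]; abel
  exact (congrArg norm e3).trans_le h2

end IsSolution

theorem deriv_sub_U {κ a b : ℝ} {A : ℝ → Mat} (hA : IsSolution κ A) (t : ℝ) :
    deriv (fun s => A s - U (a * s + b)) t = deriv A t - a • (Z * U (a * t + b)) :=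
  ((hA.hasDerivAt t).fun_sub (hasDerivAt_U a b t)).deriv

/-- A phase θ is a time shift by 2θ/x, so every phase traces the same orbit. -/
theorem rotation_mem_rotatingDiskOrbit {x : ℝ} (hx : x ≠ 0) (t θ : ℝ) :
    (U (1 / 2 * x * t + θ), (1 / 2 * x) • (Z * U (1 / 2 * x * t + θ))) ∈ rotatingDiskOrbit x := by
  refine ⟨t + 2 * θ / x, ?_⟩
  have e : 1 / 2 * x * (t + 2 * θ / x) = 1 / 2 * x * t + θ := by field_simp
  have h := (hasDerivAt_U (1 / 2 * x) 0 (t + 2 * θ / x)).deriv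
  simp only [add_zero] at h
  exact Prod.ext (congrArg U e) (h.trans (by rw [e]))

theorem isRotation_U (θ : ℝ) : IsRotation (U θ) := by
  have h : (U θ).det = 1 := by
    rw [Matrix.det_fin_two]
    simp [U]
    linarith [Real.sin_sq_add_cos_sq θ]
  rw [isRotation_iff h]
  simp [U]

/-- An exponential bound on the distance to a nearby rotation gives an exponentially weighted limit
for the distance to the orbit. -/
theorem tendsto_exp_mul_infDist {x C ν μ : ℝ} {l : Filter ℝ} {P Q : ℝ → Mat × Mat}
    (hl : Tendsto (fun t : ℝ => |t|) l atTop) (hμ : μ < ν)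
    (hQ : ∀ t, Q t ∈ rotatingDiskOrbit x)
    (hP : ∀ᶠ t in l, dist (P t) (Q t) ≤ C * Real.exp (-ν * |t|)) :
    Tendsto (fun t => Real.exp (μ * |t|) * Metric.infDist (P t) (rotatingDiskOrbit x)) l (𝓝 0) := by
  have hz : Tendsto (fun t : ℝ => C * Real.exp ((μ - ν) * |t|)) l (𝓝 (C * 0)) :=
    (Real.tendsto_exp_atBot.comp (hl.const_mul_atTop_of_neg (by linarith))).const_mul C
  rw [mul_zero] at hz
  refine squeeze_zero' (Eventually.of_forall fun t =>
    mul_nonneg (Real.exp_pos _).le Metric.infDist_nonneg) (hP.mono fun t ht => ?_) hz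
  have h1 := (Metric.infDist_le_dist_of_mem (hQ t) (x := P t)).trans ht
  refine (mul_le_mul_of_nonneg_left h1 (Real.exp_pos _).le).trans_eq ?_
  rw [mul_left_comm, ← Real.exp_add]
  congr 2; ring

end AffineMHD

theorem theorem11p2 (κ x₃ : ℝ) (hκ : 0 < κ) (hx₃ : 8 * κ < x₃ ^ 2) :
    -- `𝒲(x₃)` is nonempty, and not all of its points are rotations
    (AffineMHD.W κ x₃).Nonempty ∧
    (∃ P ∈ AffineMHD.W κ x₃, ¬ AffineMHD.IsRotation P.1) ∧
    -- `𝒲(x₃)` is invariant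
    (∀ A : ℝ → AffineMHD.Mat, AffineMHD.IsSolution κ A →
      ∀ s t : ℝ, (A s, deriv A s) ∈ AffineMHD.W κ x₃ → (A t, deriv A t) ∈ AffineMHD.W κ x₃) ∧
    -- asymptotics of the solutions in `𝒲(x₃)`
    (∀ A : ℝ → AffineMHD.Mat, AffineMHD.IsSolution κ A →
      (A 0, deriv A 0) ∈ AffineMHD.W κ x₃ →
      -- exponential convergence to rigid rotations
      (∃ T > 0, ∃ θp θm : ℝ,
        (∀ μ : ℝ, 0 < μ → μ < 1 / 2 * Real.sqrt (x₃ ^ 2 - 8 * κ) →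
          ∃ C : ℝ,
            (∀ t > T,
              ‖A t - AffineMHD.U (1 / 2 * x₃ * t + θp)‖ ≤ C * Real.exp (-μ * t) ∧
              ‖deriv (fun s => A s - AffineMHD.U (1 / 2 * x₃ * s + θp)) t‖
                ≤ C * Real.exp (-μ * t)) ∧
            (∀ t < -T,
              ‖A t - AffineMHD.U (1 / 2 * x₃ * t + θm)‖ ≤ C * Real.exp (μ * t) ∧
              ‖deriv (fun s => A s - AffineMHD.U (1 / 2 * x₃ * s + θm)) t‖
                ≤ C * Real.exp (μ * t))) ∧
        (¬ AffineMHD.IsRotation (A 0) →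
          (∀ t > T, AffineMHD.ip (A t) (deriv A t) < 0) ∧
          (∀ t < -T, 0 < AffineMHD.ip (A t) (deriv A t)))) ∧
      -- the solutions other than rigid rotations are homoclinic to the rotating disk
      (¬ AffineMHD.IsRotation (A 0) →
        (∀ t, (A t, deriv A t) ∉ AffineMHD.rotatingDiskOrbit x₃) ∧
        (∀ μ : ℝ, 0 < μ → μ < 1 / 2 * Real.sqrt (x₃ ^ 2 - 8 * κ) →
          Tendsto (fun t : ℝ => Real.exp (μ * |t|) *
            Metric.infDist (A t, deriv A t) (AffineMHD.rotatingDiskOrbit x₃)) atTop (𝓝 0) ∧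
          Tendsto (fun t : ℝ => Real.exp (μ * |t|) *
            Metric.infDist (A t, deriv A t) (AffineMHD.rotatingDiskOrbit x₃)) atBot (𝓝 0)))) := by
  have hx0 : x₃ ≠ 0 := by rintro rfl; norm_num at hx₃; linarith
  obtain ⟨P, hP, hPr⟩ := AffineMHD.exists_mem_W_not_isRotation hκ hx₃
  refine ⟨⟨P, hP⟩, ⟨P, hP, hPr⟩, fun A hA s t h => hA.mem_W t h, fun A hA h => ?_⟩
  obtain ⟨C₁, θp, h₁⟩ := hA.exists_asymptotics_atTop hκ hx₃ h
  obtain ⟨C₂, θm, h₂⟩ := hA.exists_asymptotics_atBot hκ hx₃ h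
  -- The exponential bounds hold on whole half-lines, so `T` is dictated by the sign statement
  -- alone; for a rotation any positive value will do.
  obtain ⟨T, hT, hsign⟩ : ∃ T > 0, ¬ AffineMHD.IsRotation (A 0) →
      (∀ t > T, AffineMHD.ip (A t) (deriv A t) < 0) ∧
      (∀ t < -T, 0 < AffineMHD.ip (A t) (deriv A t)) := by
    by_cases h0 : AffineMHD.IsRotation (A 0)
    · exact ⟨1, one_pos, fun h => absurd h0 h⟩
    · obtain ⟨T₁, hT₁, hs₁⟩ := hA.exists_ip_neg hκ hx₃ h h0
      obtain ⟨T₂, hT₂, hs₂⟩ := hA.exists_ip_pos hκ hx₃ h h0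
      refine ⟨max T₁ T₂, hT₁.trans_le (le_max_left _ _), fun _ => ⟨fun t ht => ?_, fun t ht => ?_⟩⟩
      · exact hs₁ t ((le_max_left _ _).trans_lt ht)
      · exact hs₂ t (by linarith [le_max_right T₁ T₂])
  refine ⟨⟨T, hT, θp, θm, fun μ _ hμ => ?_, hsign⟩, fun h0 => ⟨fun t ht => ?_, fun μ _ hμ => ⟨?_, ?_⟩⟩⟩
  · change μ < AffineMHD.rate κ x₃ at hμ
    refine ⟨max C₁ C₂, fun t ht => ?_, fun t ht => ?_⟩
    · have ht0 : 0 ≤ t := by linarith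
      have hle : C₁ * Real.exp (-AffineMHD.rate κ x₃ * t) ≤ max C₁ C₂ * Real.exp (-μ * t) := by
        have hC : 0 ≤ C₁ := nonneg_of_mul_nonneg_left
          ((norm_nonneg _).trans (h₁ t ht0).1) (Real.exp_pos _)
        exact mul_le_mul (le_max_left _ _) (Real.exp_le_exp.2 (by nlinarith))
          (Real.exp_pos _).le (hC.trans (le_max_left _ _))
      rw [AffineMHD.deriv_sub_U hA]
      exact ⟨(h₁ t ht0).1.trans hle, (h₁ t ht0).2.trans hle⟩
    · have ht0 : t ≤ 0 := by linarith
      have hle : C₂ * Real.exp (AffineMHD.rate κ x₃ * t) ≤ max C₁ C₂ * Real.exp (μ * t) := by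
        have hC : 0 ≤ C₂ := nonneg_of_mul_nonneg_left
          ((norm_nonneg _).trans (h₂ t ht0).1) (Real.exp_pos _)
        exact mul_le_mul (le_max_right _ _) (Real.exp_le_exp.2 (by nlinarith))
          (Real.exp_pos _).le (hC.trans (le_max_right _ _))
      rw [AffineMHD.deriv_sub_U hA]
      exact ⟨(h₂ t ht0).1.trans hle, (h₂ t ht0).2.trans hle⟩
  · obtain ⟨s, hs⟩ := ht
    have hs1 : AffineMHD.U (1 / 2 * x₃ * s) = A t := congrArg Prod.fst hs
    exact hA.not_isRotation hκ hx₃ h h0 t (hs1 ▸ AffineMHD.isRotation_U _)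
  · refine AffineMHD.tendsto_exp_mul_infDist (C := C₁) tendsto_abs_atTop_atTop hμ
      (fun t => AffineMHD.rotation_mem_rotatingDiskOrbit hx0 t θp)
      ((eventually_ge_atTop 0).mono fun t ht => ?_)
    rw [abs_of_nonneg ht, Prod.dist_eq, dist_eq_norm, dist_eq_norm]
    exact max_le (h₁ t ht).1 (h₁ t ht).2
  · refine AffineMHD.tendsto_exp_mul_infDist (C := C₂) tendsto_abs_atBot_atTop hμ
      (fun t => AffineMHD.rotation_mem_rotatingDiskOrbit hx0 t θm)
      ((eventually_le_atBot 0).mono fun t ht => ?_)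
    rw [abs_of_nonpos ht, neg_mul_neg, Prod.dist_eq, dist_eq_norm, dist_eq_norm]
    exact max_le (h₂ t ht).1 (h₂ t ht).2
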